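/- There is a universal constant $C>0$ such that the following holds for every finite metric space $(X,d)$ with $n\ge 2$ points. For every $1\le p\le\infty$ (with $1/\infty=0$), $$c_p(X)\le C\,\alpha_X^{1-1/p}(\log n)^{1/p}.$$ In particular, for $p=2$, $c_2(X)\le C\sqrt{\alpha_X\log n}$. Moreover $\alpha_X\le C\log\lambda_X$, and consequently $c_2(X)\le C\sqrt{\log\lambda_X\cdot\log n}$. Here: - A map $f:X\to L_p=L_p[0,1]$ is $K$-bi-Lipschitz ($K>0$) if for some $c>0$, $cK^{-1}d(x,y)\le\|f(x)-f(y)\|_p\le c\,d(x,y)$ for all $x,y\in X$. The distortion of $f$ is the infimum of such $K$, and $c_p(X)$ is the infimum of the distortions of all maps $f:X\to L_p$. - $B(x,r)=\{y\in X: d(x,y)<r\}$. For a partition $P$ of $X$, $P(x)$ denotes the cluster of $P$ that contains $x$. Given $\Delta>0$ and $\varepsilon\in(0,1]$, a $\Delta$-bounded $\varepsilon$-padded decomposition of $X$ is a probability distribution $\Pr$ on the set of partitions of $X$ such that every cluster of every partition in the support of $\Pr$ has diameter at most $\Delta$, and $\Pr[B(x,\varepsilon\Delta)\nsubseteq P(x)]\le\frac12$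 for all $x\in X$. - The modulus of padded decomposability $\alpha_X$ is the infimum of all $\alpha$ with $1/\alpha\in(0,1]$ such that for every $u\in\mathbb Z$ there is a $2^u$-bounded $(1/\alpha)$-padded decomposition of $X$. - The doubling constant $\lambda_X$ is the least integer $\lambda$ such that every ball of $X$ can be covered by $\lambda$ balls of half its radius. -/

import Mathlib

open scoped ENNReal

noncomputable section

namespace PaddedEmbedding

/-- The map `f` is `K`-bi-Lipschitz: for some scaling `C > 0` one has
`C K⁻¹ d(x,y) ≤ d(f x, f y) ≤ C d(x,y)` for all `x, y`. -/
def IsBiLipschitz {X Y : Type*} [MetricSpace X] [MetricSpace Y] (K : ℝ) (f : X → Y) : Prop :=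
  0 < K ∧ ∃ C : ℝ, 0 < C ∧ ∀ x y : X,
    C * K⁻¹ * dist x y ≤ dist (f x) (f y) ∧ dist (f x) (f y) ≤ C * dist x y

/-- The distortion `dist(f)`: the least `K` for which `f` is `K`-bi-Lipschitz
(`∞` if there is no such `K`). -/
def distortion {X Y : Type*} [MetricSpace X] [MetricSpace Y] (f : X → Y) : ℝ≥0∞ :=
  ⨅ (K : ℝ) (_ : IsBiLipschitz K f), ENNReal.ofReal K

/-- `c_Y(X)`: the least distortion with which `X` embeds into `Y`
(`∞` if it does not embed with finite distortion). -/
def leastDistortion (X Y : Type*) [MetricSpace X] [MetricSpace Y] : ℝ≥0∞ :=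
  ⨅ f : X → Y, distortion f

/-- The real Banach space `L_p = L_p[0,1]`. -/
abbrev LpSpace (p : ℝ≥0∞) : Type :=
  MeasureTheory.Lp ℝ p (MeasureTheory.volume.restrict (Set.Icc (0 : ℝ) 1))

/-- `c_p(X)`: the least distortion with which `X` embeds into `L_p`. -/
def cLp (p : ℝ≥0∞) [Fact (1 ≤ p)] (X : Type*) [MetricSpace X] : ℝ≥0∞ :=
  leastDistortion X (LpSpace p)

/-- The cluster `P(x)` of the partition `P` that contains `x`.  Partitions of `X` are
represented by equivalence relations; the clusters of `P` are the elements of `P.classes`. -/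
def cluster {X : Type*} (P : Setoid X) (x : X) : Set X := {y | P y x}

/-- The distribution `Pr` over partitions of `X` is a `Δ`-bounded `ε`-padded decomposition,
where `ε : X → (0,1]`. -/
def IsPaddedDecomposition {X : Type*} [MetricSpace X] (Δ : ℝ) (ε : X → ℝ)
    (Pr : PMF (Setoid X)) : Prop :=
  (∀ x, 0 < ε x ∧ ε x ≤ 1) ∧
  (∀ P ∈ Pr.support, ∀ C ∈ P.classes, Metric.diam C ≤ Δ) ∧
  (∀ x, Pr.toOuterMeasure {P | ¬ Metric.ball x (ε x * Δ) ⊆ cluster P x} ≤ 1 / 2)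

/-- `β` is an `ε`-padded decomposition bundle: for every integer `u`, `β u` is a
`2^u`-bounded `ε(·,u)`-padded decomposition. -/
def IsPaddedBundle {X : Type*} [MetricSpace X] (ε : X → ℤ → ℝ)
    (β : ℤ → PMF (Setoid X)) : Prop :=
  ∀ u : ℤ, IsPaddedDecomposition ((2 : ℝ) ^ u) (fun x => ε x u) (β u)

/-- The modulus of padded decomposability `α_X`. -/
def modulus (X : Type*) [MetricSpace X] : ℝ :=
  sInf {α : ℝ | ∃ β : ℤ → PMF (Setoid X), IsPaddedBundle (fun _ _ => 1 / α) β}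

/-- The doubling constant `λ_X`: the least `l` such that every ball in `X` can be covered
by `l` balls of half the radius. -/
def doublingConstant (X : Type*) [MetricSpace X] : ℕ :=
  sInf {l : ℕ | ∀ (x : X) (r : ℝ), 0 < r → ∃ S : Finset X, S.card ≤ l ∧
    Metric.ball x r ⊆ ⋃ y ∈ S, Metric.ball y (r / 2)}

end PaddedEmbedding

end

/-! For p = ∞ the Fréchet embedding is isometric. For p < ∞ the proof is a form of measured descent.
Each rank k ≤ n, scale 2^j, partition P and cluster C carries a coordinate of weight 1/k times the
probability of P: the distance to the complement of C, truncated so that it lives only where the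
distance to the k-th nearest point is comparable to 2^j (`coord`). Coordinates are 1-Lipschitz, and
for given k and P a point is seen by boundedly many scales and at each by one cluster. So the p-th
power of the image distance is at most a constant times H_n d(x,y)^p, where H_n ≤ 1 + log n
(`energy_le`).

For the lower bound, take 2^j comparable to d(x,y), and let ρ be the sum of 1/k over the ranks
reached between the radii 2^j/8 and 3·2^j around x, roughly the logarithm of a volume ratio. These
ranks contribute at least a multiple of ρ (min(ε, 1/16) 2^j)^p when the partitions are ε-padded at x
(`le_energy`). Two bundles are used together: one with ε = 1/α, α ≤ 2α_X, and one with ε of order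
1/(1+ρ), which always exists. If ρ ≥ α, the first gives at least α^(1-p) d^p up to constants; if ρ ≤
α, the second gives ρ^(1-p) d^p, which is no smaller. The second case needs ρ ≥ 1/2, true at
whichever of x, y has fewer points within 2^j/8 (`half_le_growth`). Taking p-th roots gives the
distortion.

Padding comes from carving balls of random radius in random order (`exists_isPaddedDecomposition`):
a centre cuts B(x, εΔ) only if the radius falls in a window of relative length O(ε) and the centre
precedes all those nearer to x, which has probability at most 1/rank. Summing gives O(ε · growth).
With all points as centres this is the second bundle; with a separated net the growth is at most 1 +
4 log λ_X, whence α_X = O(log λ_X). -/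

namespace PaddedEmbedding

/-! ### Realising finite families of functions in L_p[0,1] -/

open MeasureTheory

/-- The unit interval carries an `ι`-valued random variable with any prescribed law. -/
theorem exists_measurePreserving_unitInterval {ι : Type*} [Finite ι] [MeasurableSpace ι]
    [DiscreteMeasurableSpace ι] (ν : Measure ι) [IsProbabilityMeasure ν] :
    ∃ T : ℝ → ι, MeasurePreserving T (volume.restrict (Set.Icc (0 : ℝ) 1)) ν := by
  have : Nonempty ι := by
    by_contra h
    rw [not_nonempty_iff] at h
    have := measure_univ (μ := ν)
    simp [Set.univ_eq_empty_iff.2 h] at this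
  have : Countable ι := Finite.to_countable
  obtain ⟨f, hf, h⟩ := ν.exists_measurable_map_eq
  refine ⟨f ∘ Set.projIcc (0 : ℝ) 1 zero_le_one, ?_⟩
  refine (⟨hf, h⟩ : MeasurePreserving f volume ν).comp ⟨continuous_projIcc.measurable, ?_⟩
  have h2 : (volume : Measure ℝ).restrict (Set.Icc (0 : ℝ) 1) =
      (volume : Measure unitInterval).map Subtype.val :=
    (map_comap_subtype_coe measurableSet_Icc volume).symm
  rw [h2, Measure.map_map continuous_projIcc.measurable measurable_subtype_coe]
  have h3 : Set.projIcc (0 : ℝ) 1 zero_le_one ∘ Subtype.val = id :=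
    funext fun x => Set.projIcc_val zero_le_one x
  exact (congrArg (fun g => (volume : Measure unitInterval).map g) h3).trans Measure.map_id

/-- Every finite weighted family of real functions on `X` is realised isometrically by a map
from `X` into `L_p`. -/
theorem exists_toLp_dist_rpow {X ι : Type*} (p : ℝ≥0∞) [Fact (1 ≤ p)] (hp : p ≠ ∞)
    (s : Finset ι) (w : ι → ℝ) (hw : ∀ i ∈ s, 0 ≤ w i) (F : X → ι → ℝ) :
    ∃ f : X → LpSpace p, ∀ x y,
      dist (f x) (f y) ^ p.toReal = ∑ i ∈ s, w i * |F x i - F y i| ^ p.toReal := by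
  have hp1 : 1 ≤ p := Fact.out
  have hp0 : p ≠ 0 := (zero_lt_one.trans_le hp1).ne'
  have hpr : 0 < p.toReal := ENNReal.toReal_pos hp0 hp
  rcases s.eq_empty_or_nonempty with rfl | hs
  · exact ⟨fun _ => 0, fun x y => by simp [hpr.ne']⟩
  have : Nonempty s := hs.to_subtype
  let : MeasurableSpace s := ⊤
  have : DiscreteMeasurableSpace s := ⟨fun _ => trivial⟩
  let m : ℝ := Fintype.card s
  have hm : 0 < m := by simp only [m]; exact_mod_cast Fintype.card_pos
  obtain ⟨T, hT⟩ := exists_measurePreserving_unitInterval (PMF.uniformOfFintype s).toMeasure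
  -- The factor m cancels the mass 1/m of each atom of the uniform law, leaving the weight w i.
  let G : X → s → ℝ := fun x i => (m * w i) ^ (1 / p.toReal) * F x i
  have hGm : ∀ x, MemLp (G x) p (PMF.uniformOfFintype s).toMeasure := fun x => MemLp.of_discrete
  have hG : ∀ x, MemLp (G x ∘ T) p (volume.restrict (Set.Icc (0 : ℝ) 1)) :=
    fun x => (hGm x).comp_measurePreserving hT
  refine ⟨fun x => (hG x).toLp, fun x y => ?_⟩
  rw [dist_eq_norm, ← MemLp.toLp_sub, Lp.norm_toLp]
  have : G x ∘ T - G y ∘ T = (G x - G y) ∘ T := rfl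
  rw [this, eLpNorm_comp_measurePreserving ((hGm x).sub (hGm y)).1 hT,
    eLpNorm_eq_lintegral_rpow_enorm_toReal hp0 hp, ENNReal.toReal_rpow, ← ENNReal.rpow_mul,
    one_div_mul_cancel hpr.ne', ENNReal.rpow_one, lintegral_fintype, ENNReal.toReal_sum,
    ← Finset.sum_coe_sort s]
  · refine Finset.sum_congr rfl fun i _ => ?_
    have hwi := hw i i.2
    rw [PMF.toMeasure_apply_singleton _ _ (measurableSet_singleton _),
      PMF.uniformOfFintype_apply, ENNReal.toReal_mul, ← ENNReal.toReal_rpow, toReal_enorm]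
    have e : ‖(G x - G y) i‖ = (m * w i) ^ (1 / p.toReal) * |F x i - F y i| := by
      simp only [G, Pi.sub_apply, ← mul_sub, Real.norm_eq_abs, abs_mul]
      rw [abs_of_nonneg (by positivity)]
    rw [e, Real.mul_rpow (by positivity) (abs_nonneg _), ← Real.rpow_mul (by positivity),
      one_div_mul_cancel hpr.ne', Real.rpow_one]
    simp only [ENNReal.toReal_inv, ENNReal.toReal_natCast]
    change m * w i * _ * m⁻¹ = _
    field_simp
  · intro i _
    refine ENNReal.mul_ne_top (ENNReal.rpow_ne_top_of_nonneg hpr.le (by simp)) (measure_ne_top _ _)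

/-- The Fréchet embedding: a finite metric space embeds isometrically into `L_∞`. -/
theorem exists_isometry_Lp_top (X : Type*) [MetricSpace X] [Finite X] [Nonempty X] :
    ∃ f : X → LpSpace ∞, ∀ x y, dist (f x) (f y) = dist x y := by
  have := Fintype.ofFinite X
  let : MeasurableSpace X := ⊤
  have : DiscreteMeasurableSpace X := ⟨fun _ => trivial⟩
  obtain ⟨T, hT⟩ := exists_measurePreserving_unitInterval (PMF.uniformOfFintype X).toMeasure
  have hGm : ∀ x : X, MemLp (dist x) ∞ (PMF.uniformOfFintype X).toMeasure :=
    fun x => MemLp.of_discrete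
  have hG : ∀ x : X, MemLp (dist x ∘ T) ∞ (volume.restrict (Set.Icc (0 : ℝ) 1)) :=
    fun x => (hGm x).comp_measurePreserving hT
  refine ⟨fun x => (hG x).toLp, fun x y => ?_⟩
  rw [dist_eq_norm, ← MemLp.toLp_sub, Lp.norm_toLp]
  have : dist x ∘ T - dist y ∘ T = (dist x - dist y) ∘ T := rfl
  rw [this, eLpNorm_comp_measurePreserving ((hGm x).sub (hGm y)).1 hT, eLpNorm_exponent_top]
  have h1 : eLpNormEssSup (dist x - dist y) (PMF.uniformOfFintype X).toMeasure ≤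
      ENNReal.ofReal (dist x y) :=
    eLpNormEssSup_le_of_ae_bound (Filter.Eventually.of_forall fun z => by
      rw [Pi.sub_apply, Real.norm_eq_abs]; exact abs_dist_sub_le x y z)
  refine le_antisymm (ENNReal.toReal_le_of_le_ofReal dist_nonneg h1) ?_
  have h2 := ae_le_eLpNormEssSup (f := dist x - dist y) (μ := (PMF.uniformOfFintype X).toMeasure)
  -- Every atom has positive mass, so the almost sure bound holds at y, where the difference is
  -- d(x,y).
  rw [ae_iff_of_countable] at h2
  have h3 := h2 y (by
    rw [PMF.toMeasure_apply_singleton _ _ (measurableSet_singleton _)]; simp)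
  have h4 := ENNReal.toReal_mono (ne_top_of_le_ne_top ENNReal.ofReal_ne_top h1) h3
  simpa using h4

/-- A map with two-sided bounds bounds the distortion `c_p(X)`. -/
theorem cLp_le_of_bounds {X : Type*} [MetricSpace X] (p : ℝ≥0∞) [Fact (1 ≤ p)]
    (f : X → LpSpace p) {L U : ℝ} (hL : 0 < L) (hU : 0 < U)
    (h : ∀ x y, L * dist x y ≤ dist (f x) (f y) ∧ dist (f x) (f y) ≤ U * dist x y) :
    cLp p X ≤ ENNReal.ofReal (U / L) := by
  refine (iInf_le _ f).trans (iInf₂_le (U / L) ⟨by positivity, U, hU, fun x y => ?_⟩)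
  have : U * (U / L)⁻¹ = L := by field_simp
  rw [this]
  exact h x y


/-! ### Ball counts and harmonic growth -/

open Finset
open scoped Classical in
/-- The number of points of `N` within distance `s` of `x`. -/
noncomputable def ballCount {X : Type*} [MetricSpace X] (N : Finset X) (x : X) (s : ℝ) : ℕ :=
  #{z ∈ N | dist x z ≤ s}

/-- The harmonic sum over the ranks, with respect to the distance from `x`, of the points of `N`
in an annulus around `x`; it is comparable to the logarithm of a volume ratio. -/
noncomputable def growth {X : Type*} [MetricSpace X] (N : Finset X) (x : X) (s t : ℝ) : ℝ :=
  ∑ k ∈ Ioc (ballCount N x s) (ballCount N x t), (1 / k : ℝ)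

theorem ballCount_mono {X : Type*} [MetricSpace X] (N : Finset X) (x : X) :
    Monotone (ballCount N x) := fun _ _ hst =>
  card_le_card (monotone_filter_right _ fun _ _ h => le_trans h hst)

theorem growth_nonneg {X : Type*} [MetricSpace X] (N : Finset X) (x : X) (s t : ℝ) :
    0 ≤ growth N x s t := sum_nonneg fun _ _ => by positivity

theorem growth_mono {X : Type*} [MetricSpace X] (N : Finset X) (x : X) (s : ℝ) {t t' : ℝ}
    (h : t ≤ t') : growth N x s t ≤ growth N x s t' :=
  sum_le_sum_of_subset_of_nonneg (Ioc_subset_Ioc_right (ballCount_mono N x h))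
    fun _ _ _ => by positivity

theorem sum_Icc_one_div_le (n : ℕ) : ∑ k ∈ Icc 1 n, (1 / k : ℝ) ≤ 1 + Real.log n := by
  have := harmonic_le_one_add_log n
  rw [harmonic_eq_sum_Icc] at this
  push_cast at this
  simpa using this

theorem growth_le_one_add_log {X : Type*} [MetricSpace X] (N : Finset X) (x : X) (s t : ℝ) :
    growth N x s t ≤ 1 + Real.log (ballCount N x t) := by
  refine le_trans (sum_le_sum_of_subset_of_nonneg (fun k hk => ?_) fun _ _ _ => by positivity)
    (sum_Icc_one_div_le _)
  simp only [mem_Ioc, mem_Icc] at hk ⊢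
  omega

open scoped Classical in
/-- Summing the inverse ranks of the elements of `T`, all of which lie above `A`. -/
theorem sum_inv_rank_le {α : Type*} (g : α → ℝ) (A T : Finset α) (hd : Disjoint A T)
    (hA : ∀ a ∈ A, ∀ z ∈ T, g a ≤ g z) :
    ∑ z ∈ T, (1 / #{w ∈ A ∪ T | g w ≤ g z} : ℝ) ≤ ∑ k ∈ Ioc #A (#A + #T), (1 / k : ℝ) := by
  -- The largest element has rank #A + #T. Deleting it can only lower the other ranks, hence only
  -- raise their inverses.
  induction T using Finset.induction_on_max_value g with
  | empty => simp
  | insert z T hz hmax ih =>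
    have hd' : Disjoint A T := hd.mono_right (subset_insert _ _)
    have ih' := ih hd' fun a ha z hz => hA a ha z (mem_insert_of_mem hz)
    rw [sum_insert hz, card_insert_of_notMem hz, ← add_assoc, ← Nat.succ_eq_add_one,
      sum_Ioc_succ_top (by omega), add_comm]
    refine add_le_add (le_trans (sum_le_sum fun y hy => ?_) ih') (le_of_eq ?_)
    · refine one_div_le_one_div_of_le ?_ ?_
      · exact_mod_cast card_pos.2 ⟨y, by simp [hy]⟩
      · exact_mod_cast card_le_card (filter_subset_filter _
          (union_subset_union_right (subset_insert _ _)))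
    · rw [filter_true_of_mem, card_union_of_disjoint hd, card_insert_of_notMem hz]
      · simp [add_assoc]
      · intro w hw
        rcases mem_union.1 hw with h | h
        · exact hA w h z (mem_insert_self _ _)
        · rcases mem_insert.1 h with rfl | h
          · exact le_rfl
          · exact hmax w h

open scoped Classical in
theorem sum_annulus_le_growth {X : Type*} [MetricSpace X] (N : Finset X) (x : X) {s t : ℝ}
    (hst : s ≤ t) :
    ∑ z ∈ N with s < dist x z ∧ dist x z ≤ t, (1 / ballCount N x (dist x z) : ℝ) ≤
      growth N x s t := by
  set A : Finset X := {z ∈ N | dist x z ≤ s}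
  set T : Finset X := {z ∈ N | s < dist x z ∧ dist x z ≤ t}
  have hd : Disjoint A T := by
    rw [Finset.disjoint_left]
    intro a ha hb
    simp only [A, T, mem_filter] at ha hb
    linarith [ha.2, hb.2.1]
  have hu : A ∪ T = {z ∈ N | dist x z ≤ t} := by
    ext z
    simp only [A, T, mem_union, mem_filter]
    constructor
    · rintro (h | h)
      · exact ⟨h.1, h.2.trans hst⟩
      · exact ⟨h.1, h.2.2⟩
    · intro h
      by_cases h' : dist x z ≤ s
      · exact Or.inl ⟨h.1, h'⟩
      · exact Or.inr ⟨h.1, not_le.1 h', h.2⟩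
  have := sum_inv_rank_le (dist x) A T hd (by
    intro a ha z hz
    simp only [A, T, mem_filter] at ha hz
    linarith [ha.2, hz.2.1])
  rw [← card_union_of_disjoint hd, hu] at this
  refine le_trans (le_of_eq (sum_congr rfl fun z hz => ?_)) this
  simp only [T, mem_filter] at hz
  have e : ballCount N x (dist x z) =
      #{w ∈ ({w ∈ N | dist x w ≤ t} : Finset X) | dist x w ≤ dist x z} := by
    rw [filter_filter]
    exact congrArg card (filter_congr fun w _ => ⟨fun h => ⟨h.trans hz.2.2, h⟩, fun h => h.2⟩)
  rw [e]

/-! ### Random ball carving -/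

open scoped Classical in
/-- In a uniformly random ordering, a given element of `S` comes first in `S` with probability at
most `1 / |S|`. -/
theorem card_perm_first_le {X : Type*} [Fintype X] (r : X → ℕ) (hr : Function.Injective r)
    (S : Finset X) {z : X} (hz : z ∈ S) :
    (#{π : Equiv.Perm X | ∀ w ∈ S, r (π z) ≤ r (π w)} : ℝ) ≤
      Fintype.card (Equiv.Perm X) * (1 / #S) := by
  let A : X → Finset (Equiv.Perm X) := fun z => {π | ∀ w ∈ S, r (π z) ≤ r (π w)}
  -- Composing with the transposition of z and y turns orders led by z into orders led by y. The
  -- events `A y` are disjoint, so #S times the size of one is at most the number of permutations.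
  have hle : ∀ y ∈ S, #(A z) ≤ #(A y) := by
    intro y hy
    refine card_le_card_of_injOn (fun π => π * Equiv.swap z y) ?_
      fun π _ π' _ h => mul_right_cancel h
    · intro π hπ
      simp only [A, coe_filter, mem_univ, true_and, Set.mem_ofPred_eq] at hπ ⊢
      intro w hw
      rw [Equiv.Perm.mul_apply, Equiv.Perm.mul_apply, Equiv.swap_apply_right]
      refine hπ _ ?_
      by_cases h1 : w = z
      · subst h1; simpa using hy
      by_cases h2 : w = y
      · subst h2; simpa using hz
      · rwa [Equiv.swap_apply_of_ne_of_ne h1 h2]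
  have hdisj : (S : Set X).PairwiseDisjoint A := by
    intro a ha b hb hab
    rw [Function.onFun, Finset.disjoint_left]
    intro π h1 h2
    simp only [A, mem_filter, mem_univ, true_and] at h1 h2
    exact hab (π.injective (hr (le_antisymm (h1 b hb) (h2 a ha))))
  have h1 : #S * #(A z) ≤ Fintype.card (Equiv.Perm X) :=
    calc #S * #(A z) = ∑ _y ∈ S, #(A z) := by simp
      _ ≤ ∑ y ∈ S, #(A y) := sum_le_sum hle
      _ = #(S.biUnion A) := (card_biUnion hdisj).symm
      _ ≤ _ := card_le_univ _
  have hS : (0 : ℝ) < #S := by exact_mod_cast card_pos.2 ⟨z, hz⟩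
  rw [mul_one_div, le_div_iff₀ hS, mul_comm]
  exact_mod_cast h1

open scoped Classical in
/-- At most `2 t / δ + 1` points of an arithmetic progression with step `δ` lie in an open
interval of length `2 t`. -/
theorem card_progression_le (M : ℕ) {a δ D t : ℝ} (hδ : 0 < δ) (ht : 0 ≤ t) :
    (#{i : Fin M | |a + i * δ - D| < t} : ℝ) ≤ 2 * t / δ + 1 := by
  set S : Finset (Fin M) := {i | |a + i * δ - D| < t}
  have hS : ∀ i ∈ S, |a + (i : ℕ) * δ - D| < t := fun i hi => by simpa [S] using hi
  rcases S.eq_empty_or_nonempty with h | h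
  · rw [h]; simp; positivity
  · set lo := S.min' h
    set hi := S.max' h
    have hsub : S ⊆ Icc lo hi := fun i hi' => mem_Icc.2 ⟨min'_le _ _ hi', le_max' _ _ hi'⟩
    have h1 := card_le_card hsub
    rw [Fin.card_Icc] at h1
    have hlo := abs_lt.1 (hS lo (min'_mem _ _))
    have hhi := abs_lt.1 (hS hi (max'_mem _ _))
    have hle : (lo : ℕ) ≤ hi := min'_le_max' S h
    have h2 : (#S : ℝ) ≤ (hi : ℕ) + 1 - (lo : ℕ) := by
      rw [le_sub_iff_add_le]
      exact_mod_cast (by omega : #S + (lo : ℕ) ≤ (hi : ℕ) + 1)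
    have h3 : ((hi : ℕ) - (lo : ℕ) : ℝ) ≤ 2 * t / δ := by
      rw [le_div_iff₀ hδ]; linarith
    linarith


/-- Assigning every point to the first (with respect to `g`) centre within distance `R`. -/
theorem exists_first_center {X : Type*} [MetricSpace X] (N : Finset X) (g : X → ℕ) {R : ℝ}
    (hN : ∀ x, ∃ z ∈ N, dist x z ≤ R) :
    ∃ c : X → X, ∀ x, c x ∈ N ∧ dist x (c x) ≤ R ∧ ∀ w ∈ N, dist x w ≤ R → g (c x) ≤ g w := by
  classical
  have : ∀ x, ∃ z, z ∈ N ∧ dist x z ≤ R ∧ ∀ w ∈ N, dist x w ≤ R → g z ≤ g w := by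
    intro x
    obtain ⟨z, hz, h⟩ := exists_min_image {z ∈ N | dist x z ≤ R} g (by
      obtain ⟨z, hz, hz'⟩ := hN x
      exact ⟨z, mem_filter.2 ⟨hz, hz'⟩⟩)
    rw [mem_filter] at hz
    exact ⟨z, hz.1, hz.2, fun w hw hw' => h w (mem_filter.2 ⟨hw, hw'⟩)⟩
  choose c hc using this
  exact ⟨c, hc⟩

/-- If the ball `B(x, t)` is not contained in the cluster of `x`, then it is cut by a centre whose
distance from `x` is within `t` of `R` and which comes first among all centres that are
no farther from `x`. -/
theorem exists_cutting_center {X : Type*} [MetricSpace X] {N : Finset X} {g : X → ℕ}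
    (hg : Function.Injective g) {R t : ℝ} (ht : 0 < t) {c : X → X}
    (hc : ∀ x, c x ∈ N ∧ dist x (c x) ≤ R ∧ ∀ w ∈ N, dist x w ≤ R → g (c x) ≤ g w) {x : X}
    (hx : ¬ Metric.ball x t ⊆ {y | c x = c y}) :
    ∃ z ∈ N, |R - dist x z| < t ∧ ∀ w ∈ N, dist x w ≤ dist x z → g z ≤ g w := by
  classical
  -- Only centres within R + t of x can capture a point of B(x, t). If the first of them were within
  -- R - t, it would capture the whole ball.
  obtain ⟨z, hz, h⟩ := exists_min_image {z ∈ N | dist x z < R + t} g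
    ⟨c x, mem_filter.2 ⟨(hc x).1, by linarith [(hc x).2.1]⟩⟩
  rw [mem_filter] at hz
  refine ⟨z, hz.1, ?_, fun w hw hw' => h w (mem_filter.2 ⟨hw, hw'.trans_lt hz.2⟩)⟩
  rw [abs_lt]
  refine ⟨by linarith [hz.2], ?_⟩
  by_contra! hcon
  refine hx fun y hy => ?_
  have key : ∀ y ∈ Metric.ball x t, c y = z := by
    intro y hy
    rw [Metric.mem_ball] at hy
    apply hg
    apply le_antisymm
    · exact (hc y).2.2 z hz.1 (by linarith [dist_triangle y x z])
    · exact h _ (mem_filter.2 ⟨(hc y).1, by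
        linarith [dist_triangle x y (c y), dist_comm x y, (hc y).2.1]⟩)
  simp only [Set.mem_ofPred_eq]
  rw [key y hy, key x (Metric.mem_ball_self ht)]

/-- Random partitions obtained by carving balls of a random radius in random order. -/
theorem exists_isPaddedDecomposition {X : Type*} [MetricSpace X] [Finite X] (N : Finset X)
    {Δ : ℝ} (hΔ : 0 < Δ) (hN : ∀ x, ∃ z ∈ N, dist x z ≤ Δ / 4) (ε : X → ℝ)
    (hε : ∀ x, 0 < ε x) (hε' : ∀ x, ε x ≤ 1 / 8)
    (hgr : ∀ x, 18 * ε x * growth N x (Δ / 8) Δ ≤ 1) :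
    ∃ Pr : PMF (Setoid X), IsPaddedDecomposition Δ ε Pr := by
  classical
  have := Fintype.ofFinite X
  -- M equally spaced radii in [Δ/4, Δ/2) replace a continuous one. M is large enough for the +1 of
  -- `card_progression_le` to be absorbed: 8εM + 1 ≤ 9εM.
  obtain ⟨M, hM0, hM⟩ : ∃ M : ℕ, 0 < M ∧ ∀ x, 1 ≤ ε x * M := by
    choose m hm using fun x => exists_nat_ge (1 / ε x)
    refine ⟨(∑ x, m x) + 1, by omega, fun x => ?_⟩
    have h1 : (m x : ℝ) ≤ ((∑ x, m x) + 1 : ℕ) := by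
      exact_mod_cast (single_le_sum (f := m) (fun _ _ => Nat.zero_le _) (mem_univ x)).trans
        (Nat.le_succ _)
    have h2 := (hm x).trans h1
    rwa [div_le_iff₀ (hε x), mul_comm] at h2
  have hMr : (0 : ℝ) < M := by exact_mod_cast hM0
  have : Nonempty (Fin M) := ⟨⟨0, hM0⟩⟩
  obtain ⟨r, hr⟩ : ∃ r : X → ℕ, Function.Injective r :=
    ⟨fun x => Fintype.equivFin X x, Fin.val_injective.comp (Fintype.equivFin X).injective⟩
  let δ : ℝ := Δ / (4 * M)
  have hδ : 0 < δ := by positivity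
  have hMδ : M * δ = Δ / 4 := by simp only [δ]; field_simp
  let R : Fin M → ℝ := fun i => Δ / 4 + i * δ
  have hR1 : ∀ i, Δ / 4 ≤ R i := fun i => by
    have : 0 ≤ (i : ℕ) * δ := by positivity
    simp only [R]; linarith
  have hR2 : ∀ i, R i ≤ Δ / 2 := fun i => by
    have : ((i : ℕ) : ℝ) ≤ M := by exact_mod_cast i.2.le
    have := mul_le_mul_of_nonneg_right this hδ.le
    simp only [R]; linarith
  have hcen : ∀ q : Equiv.Perm X × Fin M, ∃ c : X → X, ∀ x, c x ∈ N ∧ dist x (c x) ≤ R q.2 ∧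
      ∀ w ∈ N, dist x w ≤ R q.2 → r (q.1 (c x)) ≤ r (q.1 w) := fun q =>
    exists_first_center N (fun z => r (q.1 z)) fun x => by
      obtain ⟨z, hz, h⟩ := hN x
      exact ⟨z, hz, h.trans (hR1 _)⟩
  choose c hc using hcen
  refine ⟨(PMF.uniformOfFintype (Equiv.Perm X × Fin M)).map fun q => Setoid.ker (c q),
    fun x => ⟨hε x, by linarith [hε' x]⟩, ?_, fun x => ?_⟩
  · rintro P hP C ⟨y, rfl⟩
    rw [PMF.mem_support_map_iff] at hP
    obtain ⟨q, -, rfl⟩ := hP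
    refine Metric.diam_le_of_forall_dist_le hΔ.le fun a ha b hb => ?_
    have ha' : c q a = c q y := ha
    have hb' : c q b = c q y := hb
    have h1 := (hc q a).2.1
    have h2 := (hc q b).2.1
    rw [ha'] at h1
    rw [hb'] at h2
    linarith [dist_triangle_right a b (c q y), hR2 q.2]
  · set t := ε x * Δ with htdef
    have ht : 0 < t := mul_pos (hε x) hΔ
    have ht8 : t ≤ Δ / 8 := by
      have := mul_le_mul_of_nonneg_right (hε' x) hΔ.le
      linarith
    rw [PMF.toOuterMeasure_map_apply, PMF.toOuterMeasure_uniformOfFintype_apply]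
    set B : Finset (Equiv.Perm X × Fin M) := {q | ¬ Metric.ball x t ⊆ {y | c q x = c q y}}
    -- All cutting centres lie here, since the radius is in [Δ/4, Δ/2] and t ≤ Δ/8.
    set Z : Finset X := {z ∈ N | Δ / 8 < dist x z ∧ dist x z ≤ Δ}
    let A : X → Finset (Equiv.Perm X) := fun z =>
      {π | ∀ w ∈ ({w ∈ N | dist x w ≤ dist x z} : Finset X), r (π z) ≤ r (π w)}
    let I : X → Finset (Fin M) := fun z => {i | |Δ / 4 + i * δ - dist x z| < t}
    have hsub : B ⊆ Z.biUnion fun z => A z ×ˢ I z := by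
      intro q hq
      obtain ⟨z, hz, h1, h2⟩ := exists_cutting_center (g := fun z => r (q.1 z))
        (hr.comp q.1.injective) ht (hc q) (mem_filter.1 hq).2
      have h1' := abs_lt.1 h1
      rw [mem_biUnion]
      refine ⟨z, mem_filter.2 ⟨hz, ?_, ?_⟩, mem_product.2 ⟨?_, ?_⟩⟩
      · linarith [hR1 q.2]
      · linarith [hR2 q.2]
      · refine mem_filter.2 ⟨mem_univ _, fun w hw => ?_⟩
        rw [mem_filter] at hw
        exact h2 w hw.1 hw.2
      · exact mem_filter.2 ⟨mem_univ _, h1⟩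
    set K : ℝ := (Fintype.card (Equiv.Perm X) : ℝ) with hK
    have hI : ∀ z, (#(I z) : ℝ) ≤ 9 * ε x * M := fun z => by
      refine (card_progression_le M hδ ht.le).trans ?_
      have : 2 * t / δ = 8 * ε x * M := by
        simp only [δ, htdef]; field_simp; ring
      linarith [hM x]
    have hA : ∀ z ∈ Z, (#(A z) : ℝ) ≤ K * (1 / ballCount N x (dist x z)) := fun z hz =>
      card_perm_first_le r hr _ (mem_filter.2 ⟨(mem_filter.1 hz).1, le_rfl⟩)
    have hB : (#B : ℝ) ≤ K * M / 2 := by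
      have h0 : (#B : ℝ) ≤ ∑ z ∈ Z, (#(A z) : ℝ) * #(I z) := by
        refine (Nat.cast_le.2 ((card_le_card hsub).trans card_biUnion_le)).trans ?_
        push_cast [card_product]
        exact le_rfl
      calc (#B : ℝ) ≤ ∑ z ∈ Z, (#(A z) : ℝ) * #(I z) := h0
        _ ≤ ∑ z ∈ Z, K * (1 / ballCount N x (dist x z)) * (9 * ε x * M) :=
          sum_le_sum fun z hz => mul_le_mul (hA z hz) (hI z) (by positivity) (by positivity)
        _ = K * M * (9 * ε x * ∑ z ∈ Z, (1 / ballCount N x (dist x z) : ℝ)) := by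
          rw [mul_sum, mul_sum]
          exact sum_congr rfl fun z _ => by ring
        _ ≤ K * M * (9 * ε x * growth N x (Δ / 8) Δ) := by
          have := hε x
          gcongr
          exact sum_annulus_le_growth N x (by linarith)
        _ ≤ K * M * (1 / 2) := by
          gcongr
          linarith [hgr x]
        _ = _ := by ring
    have hcardB : Fintype.card ↑((fun q => Setoid.ker (c q)) ⁻¹'
        {P : Setoid X | ¬ Metric.ball x t ⊆ cluster P x}) = #B := by
      rw [← Set.toFinset_card]
      congr 1
      ext q
      simp only [Set.mem_toFinset, B, mem_filter, mem_univ, true_and, Set.mem_preimage,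
        Set.mem_ofPred_eq]
      rw [show cluster (Setoid.ker (c q)) x = {y | c q x = c q y} from
        Set.ext fun y => eq_comm]
    rw [hcardB, Fintype.card_prod, Fintype.card_fin]
    refine ENNReal.div_le_of_le_mul ?_
    rw [one_div, ← ENNReal.div_eq_inv_mul, ENNReal.le_div_iff_mul_le (by simp) (by simp)]
    have : (#B : ℝ) * 2 ≤ Fintype.card (Equiv.Perm X) * M := by linarith
    exact_mod_cast this


/-! ### Rank radii -/

section Rank
variable {X : Type*} [MetricSpace X] [Fintype X]

/-- The distance from `x` to its `k`-th nearest point, `x` itself being the first. -/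
noncomputable def rankRadius (k : ℕ) (x : X) : ℝ := sInf {s | k ≤ ballCount univ x s}

theorem ballCount_le_card (x : X) (s : ℝ) : ballCount univ x s ≤ Fintype.card X :=
  card_le_univ _

theorem ballCount_of_neg (x : X) {s : ℝ} (hs : s < 0) : ballCount univ x s = 0 := by
  simp only [ballCount, card_eq_zero, filter_eq_empty_iff, mem_univ, true_implies, not_le]
  exact fun z => hs.trans_le dist_nonneg

theorem one_le_ballCount (x : X) {s : ℝ} (hs : 0 ≤ s) : 1 ≤ ballCount univ x s :=
  card_pos.2 ⟨x, by simpa using hs⟩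

/-- For k = 0 every real s qualifies and the infimum is a default value; hence ranks start at 1. -/
theorem bddBelow_rankRadius {k : ℕ} (hk : 1 ≤ k) (x : X) :
    BddBelow {s | k ≤ ballCount univ x s} := by
  refine ⟨0, fun s hs => ?_⟩
  by_contra! h
  have hs' : k ≤ ballCount univ x s := hs
  rw [ballCount_of_neg x h] at hs'
  omega

theorem rankRadius_le {k : ℕ} (hk : 1 ≤ k) {x : X} {s : ℝ} (h : k ≤ ballCount univ x s) :
    rankRadius k x ≤ s := csInf_le (bddBelow_rankRadius hk x) h

theorem ballCount_le_ballCount_add (x y : X) (s : ℝ) :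
    ballCount univ x s ≤ ballCount univ y (s + dist x y) :=
  card_le_card (monotone_filter_right _ fun z _ (h : dist x z ≤ s) =>
    (by linarith [dist_triangle y x z, dist_comm x y] : dist y z ≤ s + dist x y))

theorem nonempty_rankRadius {k : ℕ} (hk : k ≤ Fintype.card X) (x : X) :
    {s | k ≤ ballCount univ x s}.Nonempty := by
  obtain ⟨s, hs⟩ := (Set.finite_range (dist x)).bddAbove
  refine ⟨s, ?_⟩
  have : ballCount univ x s = Fintype.card X := by
    rw [ballCount, filter_true_of_mem fun z _ => hs ⟨z, rfl⟩, card_univ]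
  exact hk.trans this.ge

theorem le_rankRadius {k : ℕ} (hk : k ≤ Fintype.card X) {x : X} {s : ℝ}
    (h : ballCount univ x s < k) : s ≤ rankRadius k x := by
  refine le_csInf (nonempty_rankRadius hk x) fun s' hs' => ?_
  by_contra! hlt
  exact absurd (le_trans hs' (ballCount_mono univ x hlt.le)) (not_le.2 h)

theorem rankRadius_le_add {k : ℕ} (hk : 1 ≤ k) (hk' : k ≤ Fintype.card X) (x y : X) :
    rankRadius k x ≤ rankRadius k y + dist x y := by
  rw [← sub_le_iff_le_add]
  refine le_csInf (nonempty_rankRadius hk' y) fun s hs => ?_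
  rw [sub_le_iff_le_add]
  refine rankRadius_le hk (le_trans hs ?_)
  rw [dist_comm]
  exact ballCount_le_ballCount_add y x s

theorem abs_rankRadius_sub_le {k : ℕ} (hk : 1 ≤ k) (hk' : k ≤ Fintype.card X) (x y : X) :
    |rankRadius k x - rankRadius k y| ≤ dist x y := by
  rw [abs_le]
  constructor
  · linarith [rankRadius_le_add hk hk' y x, dist_comm x y]
  · linarith [rankRadius_le_add hk hk' x y]

/-- At the scale of `d(x, y)`, the smaller of the two balls around `x` and `y` at least doubles. -/
theorem half_le_growth {x y : X} {Δ : ℝ} (h1 : Δ < dist x y) (h2 : dist x y ≤ 2 * Δ)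
    (h : ballCount univ x (Δ / 8) ≤ ballCount univ y (Δ / 8)) :
    1 / 2 ≤ growth univ x (Δ / 8) (3 * Δ) := by
  classical
  have hΔ : 0 < Δ := by linarith
  set a := ballCount univ x (Δ / 8) with ha
  have ha1 : 1 ≤ a := one_le_ballCount x (by linarith)
  have hd : Disjoint (univ.filter fun z => dist x z ≤ Δ / 8)
      (univ.filter fun z => dist y z ≤ Δ / 8) := by
    rw [Finset.disjoint_left]
    intro z hz hz'
    simp only [mem_filter, mem_univ, true_and] at hz hz'
    linarith [dist_triangle_right x y z]
  -- The two disjoint balls of radius Δ/8 both lie within 2Δ + Δ/8 ≤ 3Δ of x, and the one around y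
  -- is at least as populous.
  have hb : 2 * a ≤ ballCount univ x (3 * Δ) := by
    have h3 : ballCount univ x (Δ / 8) + ballCount univ y (Δ / 8) ≤
        ballCount univ x (3 * Δ) := by
      rw [ballCount, ballCount, ballCount, ← card_union_of_disjoint hd]
      refine card_le_card fun z hz => ?_
      simp only [mem_union, mem_filter, mem_univ, true_and] at hz ⊢
      rcases hz with hz | hz
      · linarith
      · linarith [dist_triangle x y z]
    omega
  calc (1 / 2 : ℝ) = ∑ k ∈ Ioc a (2 * a), (1 / (2 * a : ℝ)) := by
        have : (0 : ℝ) < a := by exact_mod_cast ha1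
        rw [sum_const, Nat.card_Ioc, show 2 * a - a = a by omega, nsmul_eq_mul]
        field_simp
    _ ≤ ∑ k ∈ Ioc a (2 * a), (1 / k : ℝ) := by
        refine sum_le_sum fun k hk => ?_
        rw [mem_Ioc] at hk
        refine one_div_le_one_div_of_le ?_ ?_
        · exact_mod_cast (by omega : 0 < k)
        · exact_mod_cast hk.2
    _ ≤ growth univ x (Δ / 8) (3 * Δ) :=
        sum_le_sum_of_subset_of_nonneg (Ioc_subset_Ioc_right hb) fun _ _ _ => by positivity

end Rank

/-! ### Clusters and the coordinates of the embedding -/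

theorem mem_cluster_self {X : Type*} (P : Setoid X) (x : X) : x ∈ cluster P x := P.refl x

theorem cluster_mem_classes {X : Type*} (P : Setoid X) (x : X) : cluster P x ∈ P.classes := ⟨x, rfl⟩

theorem eq_cluster_of_mem {X : Type*} {P : Setoid X} {C : Set X} (hC : C ∈ P.classes) {x : X} (hx : x ∈ C) :
    C = cluster P x :=
  Setoid.eq_of_mem_classes hC hx (cluster_mem_classes P x) (mem_cluster_self P x)

theorem sum_toReal_eq_one {α : Type*} [Fintype α] (Q : PMF α) : ∑ a, (Q a).toReal = 1 := by
  rw [← ENNReal.toReal_sum fun a _ => Q.apply_ne_top a, ← tsum_fintype (L := .unconditional α),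
    Q.tsum_coe, ENNReal.toReal_one]

section Descent
variable {X : Type*} [MetricSpace X] [Fintype X]

open scoped Classical in
/-- The coordinate of the embedding at scale `2 ^ j` and rank `k` that belongs to the cluster `C`
of the partition `P`. -/
noncomputable def coord (k : ℕ) (j : ℤ) (P : Setoid X) (C : Set X) (x : X) : ℝ :=
  if C ∈ P.classes then
    max 0 (min (Metric.infDist x Cᶜ)
      (min (rankRadius k x - (2 : ℝ) ^ j / 16) (4 * (2 : ℝ) ^ j - rankRadius k x)))
  else 0

theorem abs_coord_sub_le {k : ℕ} (hk : 1 ≤ k) (hk' : k ≤ Fintype.card X) (j : ℤ) (P : Setoid X)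
    (C : Set X) (x y : X) : |coord k j P C x - coord k j P C y| ≤ dist x y := by
  unfold coord
  split_ifs with h
  · refine (abs_max_sub_max_le_max _ _ _ _).trans (max_le (by simp) ?_)
    refine (abs_min_sub_min_le_max _ _ _ _).trans (max_le ?_ ?_)
    · rw [abs_le]
      constructor
      · linarith [Metric.infDist_le_infDist_add_dist (s := Cᶜ) (x := y) (y := x), dist_comm x y]
      · linarith [Metric.infDist_le_infDist_add_dist (s := Cᶜ) (x := x) (y := y)]
    · refine (abs_min_sub_min_le_max _ _ _ _).trans (max_le ?_ ?_)
      · rw [sub_sub_sub_cancel_right]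
        exact abs_rankRadius_sub_le hk hk' x y
      · rw [sub_sub_sub_cancel_left, abs_sub_comm]
        exact abs_rankRadius_sub_le hk hk' x y
  · simp

theorem coord_eq_zero {k : ℕ} {j : ℤ} {P : Setoid X} {C : Set X} {x : X}
    (h : ¬ (C = cluster P x ∧ (2 : ℝ) ^ j / 16 < rankRadius k x ∧
      rankRadius k x < 4 * (2 : ℝ) ^ j)) : coord k j P C x = 0 := by
  unfold coord
  split_ifs with hC
  · rw [max_eq_left_iff]
    by_contra! hlt
    obtain ⟨h1, h2, h3⟩ := by simpa only [lt_min_iff] using hlt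
    refine h ⟨eq_cluster_of_mem hC ?_, by linarith, by linarith⟩
    by_contra hx
    rw [Metric.infDist_zero_of_mem (Set.mem_compl hx)] at h1
    exact lt_irrefl _ h1
  · rfl

open scoped Classical in
/-- The indicator that the `k`-th rank radius at `x` is comparable to `2 ^ j`. -/
noncomputable def active (k : ℕ) (j : ℤ) (x : X) : ℝ :=
  if (2 : ℝ) ^ j / 16 < rankRadius k x ∧ rankRadius k x < 4 * (2 : ℝ) ^ j then 1 else 0

theorem active_nonneg (k : ℕ) (j : ℤ) (x : X) : 0 ≤ active k j x := by
  unfold active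
  split_ifs <;> norm_num

/-- A positive radius r is active only for 2^j in the open interval (r/4, 16r), whose endpoints have
ratio 2^6. -/
theorem sum_active_le (k : ℕ) (J : Finset ℤ) (x : X) : ∑ j ∈ J, active k j x ≤ 6 := by
  classical
  rcases le_or_gt (rankRadius k x) 0 with h | h
  · refine le_trans (sum_nonpos fun j _ => ?_) (by norm_num)
    have : (0 : ℝ) < 2 ^ j := by positivity
    rw [active, if_neg]
    rintro ⟨h1, -⟩
    linarith
  · obtain ⟨i, hi1, hi2⟩ := exists_mem_Ico_zpow h one_lt_two
    unfold active
    rw [sum_boole]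
    have hsub : (J.filter fun j => (2 : ℝ) ^ j / 16 < rankRadius k x ∧
        rankRadius k x < 4 * (2 : ℝ) ^ j) ⊆ Icc (i - 1) (i + 4) := by
      intro j hj
      obtain ⟨-, h1, h2⟩ := mem_filter.1 hj
      rw [mem_Icc]
      constructor
      · have : (2 : ℝ) ^ i < 2 ^ (j + 2) := by
          rw [zpow_add₀ two_ne_zero]; norm_num; linarith
        have := (zpow_lt_zpow_iff_right₀ one_lt_two).1 this
        omega
      · have : (2 : ℝ) ^ j < 2 ^ (i + 1 + 4) := by
          rw [zpow_add₀ two_ne_zero (i + 1)]; norm_num; linarith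
        have := (zpow_lt_zpow_iff_right₀ one_lt_two).1 this
        omega
    have := card_le_card hsub
    rw [Int.card_Icc, show (i + 4 + 1 - (i - 1)).toNat = 6 by omega] at this
    exact_mod_cast this

-- If neither x nor y is active in C, both coordinates vanish; otherwise the bracket is at least 1
-- and the Lipschitz bound suffices.
open scoped Classical in
theorem abs_coord_sub_rpow_le {p : ℝ} (hp : 0 < p) {k : ℕ} (hk : 1 ≤ k)
    (hk' : k ≤ Fintype.card X) (j : ℤ) (P : Setoid X) (C : Set X) (x y : X) :
    |coord k j P C x - coord k j P C y| ^ p ≤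
      ((if C = cluster P x then active k j x else 0) +
        if C = cluster P y then active k j y else 0) * dist x y ^ p := by
  have hnn : ∀ z : X, 0 ≤ if C = cluster P z then active k j z else 0 := fun z => by
    split_ifs
    exacts [active_nonneg k j z, le_rfl]
  have h1 : ∀ z : X, (C = cluster P z ∧ (2 : ℝ) ^ j / 16 < rankRadius k z ∧
      rankRadius k z < 4 * (2 : ℝ) ^ j) → (if C = cluster P z then active k j z else 0) = 1 := by
    rintro z ⟨h, h'⟩
    rw [if_pos h, active, if_pos h']
  have hle : |coord k j P C x - coord k j P C y| ^ p ≤ dist x y ^ p :=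
    Real.rpow_le_rpow (abs_nonneg _) (abs_coord_sub_le hk hk' j P C x y) hp.le
  have hd : 0 ≤ dist x y ^ p := Real.rpow_nonneg dist_nonneg _
  by_cases hx : C = cluster P x ∧ (2 : ℝ) ^ j / 16 < rankRadius k x ∧
      rankRadius k x < 4 * (2 : ℝ) ^ j
  · refine hle.trans (le_mul_of_one_le_left hd ?_)
    linarith [hnn y, h1 x hx]
  by_cases hy : C = cluster P y ∧ (2 : ℝ) ^ j / 16 < rankRadius k y ∧
      rankRadius k y < 4 * (2 : ℝ) ^ j
  · refine hle.trans (le_mul_of_one_le_left hd ?_)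
    linarith [hnn x, h1 y hy]
  rw [coord_eq_zero hx, coord_eq_zero hy, sub_self, abs_zero, Real.zero_rpow hp.ne']
  exact mul_nonneg (add_nonneg (hnn x) (hnn y)) hd

/-- The coordinate of a padded cluster separates `x` from `y`. -/
theorem le_abs_coord_sub {k : ℕ} (hk : k ≤ Fintype.card X) {j : ℤ} {P : Setoid X} {x y : X}
    {e : ℝ} (hdiam : Metric.diam (cluster P x) ≤ 2 ^ j) (hxy : (2 : ℝ) ^ j < dist x y)
    (hpad : Metric.ball x (e * 2 ^ j) ⊆ cluster P x)
    (h1 : ballCount univ x ((2 : ℝ) ^ j / 8) < k)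
    (h2 : k ≤ ballCount univ x (3 * (2 : ℝ) ^ j)) :
    min e (1 / 16) * 2 ^ j ≤ |coord k j P (cluster P x) x - coord k j P (cluster P x) y| := by
  have h2j : (0 : ℝ) < 2 ^ j := by positivity
  have hy : y ∉ cluster P x := fun hy => by
    have := Metric.dist_le_diam_of_mem (Set.toFinite (cluster P x)).isBounded
      (mem_cluster_self P x) hy
    linarith
  have hy0 : coord k j P (cluster P x) y = 0 :=
    coord_eq_zero fun h => hy (h.1 ▸ mem_cluster_self P y)
  rw [hy0, sub_zero]
  refine le_trans ?_ (le_abs_self _)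
  rw [coord, if_pos (cluster_mem_classes P x)]
  -- The rank radius lies in [2^j/8, 3·2^j], hence at least 2^j/16 inside both ends of the window
  -- (2^j/16, 4·2^j).
  have hr1 := le_rankRadius hk h1
  have hr2 := rankRadius_le (by omega) h2
  have hm1 : min e (1 / 16) * (2 : ℝ) ^ j ≤ e * 2 ^ j :=
    mul_le_mul_of_nonneg_right (min_le_left _ _) h2j.le
  have hm2 : min e (1 / 16) * (2 : ℝ) ^ j ≤ 1 / 16 * 2 ^ j :=
    mul_le_mul_of_nonneg_right (min_le_right _ _) h2j.le
  refine le_max_of_le_right (le_min (hm1.trans ?_) (le_min ?_ ?_))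
  -- The witness y matters: `Metric.infDist` to an empty complement would be 0.
  · refine (Metric.le_infDist ⟨y, hy⟩).2 fun z hz => ?_
    by_contra! hlt
    exact hz (hpad (by rwa [Metric.mem_ball, dist_comm]))
  · linarith
  · linarith

/-! ### Upper and lower bounds for the energy -/

variable [Fintype (Setoid X)] [Fintype (Set X)]

/-- The index set of the coordinates of the embedding. -/
noncomputable def coordIndex (X : Type*) [Fintype X] [Fintype (Setoid X)] [Fintype (Set X)]
    (J : Finset ℤ) : Finset (ℕ × ℤ × Setoid X × Set X) :=
  Icc 1 (Fintype.card X) ×ˢ J ×ˢ univ ×ˢ univ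

/-- The `p`-th power of the distance between `x` and `y` in the embedding that is built from the
random partitions `β`. -/
noncomputable def energy (β : ℤ → PMF (Setoid X)) (J : Finset ℤ) (p : ℝ) (x y : X) : ℝ :=
  ∑ i ∈ coordIndex X J, (1 / i.1 * (β i.2.1 i.2.2.1).toReal : ℝ) *
    |coord i.1 i.2.1 i.2.2.1 i.2.2.2 x - coord i.1 i.2.1 i.2.2.1 i.2.2.2 y| ^ p

theorem energy_eq (β : ℤ → PMF (Setoid X)) (J : Finset ℤ) (p : ℝ) (x y : X) :
    energy β J p x y = ∑ k ∈ Icc 1 (Fintype.card X), ∑ j ∈ J, ∑ P, ∑ C,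
      (1 / k * (β j P).toReal : ℝ) * |coord k j P C x - coord k j P C y| ^ p := by
  simp only [energy, coordIndex, sum_product]

theorem energy_le (β : ℤ → PMF (Setoid X)) (J : Finset ℤ) {p : ℝ} (hp : 0 < p) (x y : X) :
    energy β J p x y ≤ 12 * (∑ k ∈ Icc 1 (Fintype.card X), (1 / k : ℝ)) * dist x y ^ p := by
  classical
  rw [energy_eq, mul_sum, sum_mul]
  refine sum_le_sum fun k hk => ?_
  rw [mem_Icc] at hk
  have hd : 0 ≤ dist x y ^ p := Real.rpow_nonneg dist_nonneg _
  calc ∑ j ∈ J, ∑ P, ∑ C, (1 / k * (β j P).toReal : ℝ) * |coord k j P C x - coord k j P C y| ^ p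
      ≤ ∑ j ∈ J, ∑ P, (1 / k * (β j P).toReal : ℝ) *
          ((active k j x + active k j y) * dist x y ^ p) := by
        refine sum_le_sum fun j _ => sum_le_sum fun P _ => ?_
        rw [← mul_sum]
        refine mul_le_mul_of_nonneg_left ?_ (by positivity)
        refine (sum_le_sum fun C _ => abs_coord_sub_rpow_le hp hk.1 hk.2 j P C x y).trans ?_
        rw [← sum_mul, sum_add_distrib, sum_ite_eq' univ, sum_ite_eq' univ]
        simp
    _ = ∑ j ∈ J, (1 / k : ℝ) * ((active k j x + active k j y) * dist x y ^ p) := by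
        refine sum_congr rfl fun j _ => ?_
        rw [← sum_mul, ← mul_sum, sum_toReal_eq_one, mul_one]
    _ = (1 / k : ℝ) * dist x y ^ p * (∑ j ∈ J, active k j x + ∑ j ∈ J, active k j y) := by
        rw [← sum_add_distrib, mul_sum]
        exact sum_congr rfl fun j _ => by ring
    _ ≤ (1 / k : ℝ) * dist x y ^ p * (6 + 6) := by
        gcongr
        exacts [sum_active_le k J x, sum_active_le k J y]
    _ = 12 * (1 / k : ℝ) * dist x y ^ p := by ring

theorem le_energy {β : ℤ → PMF (Setoid X)} {J : Finset ℤ} {p : ℝ} (hp : 0 < p) {x y : X}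
    {j : ℤ} (hj : j ∈ J) {ε : X → ℝ} (hβ : IsPaddedDecomposition ((2 : ℝ) ^ j) ε (β j))
    (hxy : (2 : ℝ) ^ j < dist x y) :
    growth univ x ((2 : ℝ) ^ j / 8) (3 * 2 ^ j) / 2 * (min (ε x) (1 / 16) * 2 ^ j) ^ p ≤
      energy β J p x y := by
  classical
  obtain ⟨hε, hdiam, hpad⟩ := hβ
  set v : ℝ := (min (ε x) (1 / 16) * 2 ^ j) ^ p
  have hmin : 0 < min (ε x) (1 / 16) := lt_min (hε x).1 (by norm_num)
  have hv : 0 ≤ v := by positivity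
  -- The mass of the partitions padded at x, at least 1/2 in total. Each of them separates x from y
  -- through the single cluster of x.
  set G : Setoid X → ℝ := fun P =>
    if Metric.ball x (ε x * 2 ^ j) ⊆ cluster P x then (β j P).toReal else 0
  have hG : 1 / 2 ≤ ∑ P, G P := by
    have h1 := hpad x
    rw [PMF.toOuterMeasure_apply_fintype] at h1
    have h2 := ENNReal.toReal_mono (by simp) h1
    rw [ENNReal.toReal_sum] at h2
    swap
    · intro P _
      exact ne_top_of_le_ne_top ((β j).apply_ne_top P) (Set.indicator_le_self _ _ _)
    have h3 : ∑ P, ((Set.indicator {P | ¬ Metric.ball x (ε x * 2 ^ j) ⊆ cluster P x}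
        (β j) P).toReal + G P) = 1 := by
      rw [← sum_toReal_eq_one (β j)]
      refine sum_congr rfl fun P _ => ?_
      by_cases h : Metric.ball x (ε x * 2 ^ j) ⊆ cluster P x <;> simp [G, h]
    rw [sum_add_distrib] at h3
    have h4 : ((1 : ℝ≥0∞) / 2).toReal = 1 / 2 := by simp
    rw [h4] at h2
    linarith
  have hnn : ∀ (k : ℕ) (i : ℤ) (P : Setoid X) (C : Set X),
      0 ≤ (1 / k * (β i P).toReal : ℝ) * |coord k i P C x - coord k i P C y| ^ p :=
    fun k i P C => by positivity
  have hk : ∀ k ∈ Ioc (ballCount univ x ((2 : ℝ) ^ j / 8)) (ballCount univ x (3 * 2 ^ j)),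
      (1 / k : ℝ) * (v / 2) ≤ ∑ i ∈ J, ∑ P, ∑ C,
        (1 / k * (β i P).toReal : ℝ) * |coord k i P C x - coord k i P C y| ^ p := by
    intro k hk
    rw [mem_Ioc] at hk
    refine le_trans ?_ (single_le_sum (f := fun i => ∑ P, ∑ C,
        (1 / k * (β i P).toReal : ℝ) * |coord k i P C x - coord k i P C y| ^ p)
      (fun i _ => sum_nonneg fun P _ => sum_nonneg fun C _ => hnn k i P C) hj)
    calc (1 / k : ℝ) * (v / 2) ≤ (1 / k : ℝ) * v * ∑ P, G P := by
          have : 0 ≤ (1 / k : ℝ) * v := by positivity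
          nlinarith
      _ = ∑ P, (1 / k : ℝ) * v * G P := mul_sum _ _ _
      _ ≤ _ := sum_le_sum fun P _ => ?_
    refine le_trans ?_ (single_le_sum (fun C _ => hnn k j P C) (mem_univ (cluster P x)))
    by_cases hP : Metric.ball x (ε x * 2 ^ j) ⊆ cluster P x
    · by_cases h0 : β j P = 0
      · simp [G, h0]
      · have hle : v ≤ |coord k j P (cluster P x) x - coord k j P (cluster P x) y| ^ p :=
          Real.rpow_le_rpow (by positivity) (le_abs_coord_sub (hk.2.trans (ballCount_le_card _ _))
            (hdiam P ((PMF.mem_support_iff _ _).2 h0) _ (cluster_mem_classes P x)) hxy hP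
            hk.1 hk.2) hp.le
        simp only [G, if_pos hP]
        rw [mul_right_comm]
        exact mul_le_mul_of_nonneg_left hle (by positivity)
    · simp only [G, if_neg hP, mul_zero]
      exact hnn k j P _
  rw [energy_eq, growth, div_mul_eq_mul_div, mul_div_assoc, sum_mul]
  refine (sum_le_sum hk).trans (sum_le_sum_of_subset_of_nonneg (fun k hk => ?_)
    fun k _ _ => sum_nonneg fun i _ => sum_nonneg fun P _ => sum_nonneg fun C _ => hnn k i P C)
  rw [mem_Ioc] at hk
  have := ballCount_le_card x (3 * (2 : ℝ) ^ j)
  exact mem_Icc.2 ⟨by omega, by omega⟩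

end Descent

/-! ### Doubling spaces -/

section Doubling
variable {X : Type*} [MetricSpace X] [Fintype X]

theorem exists_cover_half (x : X) {r : ℝ} (hr : 0 < r) :
    ∃ S : Finset X, #S ≤ doublingConstant X ∧
      Metric.ball x r ⊆ ⋃ y ∈ S, Metric.ball y (r / 2) := by
  have h : doublingConstant X ∈ {l : ℕ | ∀ (x : X) (r : ℝ), 0 < r → ∃ S : Finset X, S.card ≤ l ∧
      Metric.ball x r ⊆ ⋃ y ∈ S, Metric.ball y (r / 2)} :=
    Nat.sInf_mem ⟨Fintype.card X, fun x r hr => ⟨univ, card_univ.le, fun y _ =>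
      Set.mem_iUnion₂.2 ⟨y, mem_univ y, Metric.mem_ball_self (half_pos hr)⟩⟩⟩
  exact h x r hr

theorem exists_cover_pow (k : ℕ) (x : X) {r : ℝ} (hr : 0 < r) :
    ∃ S : Finset X, #S ≤ doublingConstant X ^ k ∧
      Metric.ball x r ⊆ ⋃ y ∈ S, Metric.ball y (r / 2 ^ k) := by
  classical
  induction k with
  | zero => exact ⟨{x}, by simp, by simp⟩
  | succ k ih =>
    obtain ⟨S, hS, hcov⟩ := ih
    choose T hT hTcov using fun y : X => exists_cover_half y (r := r / 2 ^ k) (by positivity)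
    refine ⟨S.biUnion T, ?_, fun z hz => ?_⟩
    · rw [pow_succ]
      exact (card_biUnion_le_card_mul S T _ fun y _ => hT y).trans (Nat.mul_le_mul_right _ hS)
    · obtain ⟨y, hy, hzy⟩ := Set.mem_iUnion₂.1 (hcov hz)
      obtain ⟨w, hw, hzw⟩ := Set.mem_iUnion₂.1 (hTcov y hzy)
      refine Set.mem_iUnion₂.2 ⟨w, mem_biUnion.2 ⟨y, hy, hw⟩, ?_⟩
      rwa [pow_succ, ← div_div]

theorem two_le_doublingConstant [Nontrivial X] : 2 ≤ doublingConstant X := by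
  by_contra! hlt
  obtain ⟨x, y, hxy⟩ := exists_pair_ne X
  have hd : 0 < dist x y := dist_pos.2 hxy
  obtain ⟨S, hS, hcov⟩ := exists_cover_pow 2 x (r := 2 * dist x y) (by linarith)
  have hS1 : #S ≤ 1 := hS.trans (Nat.pow_le_one_iff (by norm_num) |>.2 (by omega))
  obtain ⟨z, hz, hxz⟩ := Set.mem_iUnion₂.1 (hcov (Metric.mem_ball_self (by linarith)))
  obtain ⟨w, hw, hyw⟩ := Set.mem_iUnion₂.1
    (hcov (show y ∈ Metric.ball x (2 * dist x y) by rw [Metric.mem_ball, dist_comm]; linarith))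
  obtain rfl := card_le_one.1 hS1 z hz w hw
  rw [Metric.mem_ball] at hxz hyw
  linarith [dist_triangle_right x y z]

/-- Separated subsets of a ball are small. -/
theorem ballCount_le_doublingConstant_pow (N : Finset X) {Δ : ℝ} (hΔ : 0 < Δ)
    (hsep : ∀ a ∈ N, ∀ b ∈ N, a ≠ b → Δ / 4 < dist a b) (x : X) :
    ballCount N x Δ ≤ doublingConstant X ^ 4 := by
  classical
  -- Four halvings of 2Δ give radius Δ/8, and two points in one such ball are less than Δ/4 apart.
  obtain ⟨S, hS, hcov⟩ := exists_cover_pow 4 x (r := 2 * Δ) (by linarith)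
  refine le_trans ?_ hS
  have h : ∀ z ∈ ({z ∈ N | dist x z ≤ Δ} : Finset X), ∃ y ∈ S, dist z y < Δ / 8 := by
    intro z hz
    have hz' := (mem_filter.1 hz).2
    obtain ⟨y, hy, hzy⟩ := Set.mem_iUnion₂.1
      (hcov (show z ∈ Metric.ball x (2 * Δ) by rw [Metric.mem_ball, dist_comm]; linarith))
    rw [Metric.mem_ball] at hzy
    exact ⟨y, hy, by linarith⟩
  choose! f hf hf' using h
  refine card_le_card_of_injOn f hf fun a ha b hb hab => ?_
  by_contra hne
  have h1 := hsep a (mem_filter.1 ha).1 b (mem_filter.1 hb).1 hne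
  have h2 := hf' a ha
  have h3 := hf' b hb
  rw [← hab] at h3
  linarith [dist_triangle_right a b (f a)]

theorem exists_separated_net {s : ℝ} (hs : 0 ≤ s) :
    ∃ N : Finset X, (∀ a ∈ N, ∀ b ∈ N, a ≠ b → s < dist a b) ∧ ∀ x, ∃ z ∈ N, dist x z ≤ s := by
  classical
  obtain ⟨N, hN⟩ := (Set.toFinite
    {N : Finset X | ∀ a ∈ N, ∀ b ∈ N, a ≠ b → s < dist a b}).exists_maximal ⟨∅, by simp⟩
  refine ⟨N, hN.prop, fun x => ?_⟩
  by_contra! hx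
  have hmem : insert x N ∈ {N : Finset X | ∀ a ∈ N, ∀ b ∈ N, a ≠ b → s < dist a b} := by
    intro a ha b hb hab
    rcases mem_insert.1 ha with rfl | ha' <;> rcases mem_insert.1 hb with rfl | hb'
    · exact absurd rfl hab
    · exact hx b hb'
    · rw [dist_comm]; exact hx a ha'
    · exact hN.prop a ha' b hb' hab
  have := hN.le_of_ge hmem (subset_insert x N) (mem_insert_self x N)
  have := hx x this
  rw [dist_self] at this
  linarith

/-- Carving around a Δ/4-separated net has growth at most 1 + 4 log λ. The constant 108 ensures 18(1
+ 4 log λ) ≤ 108 log λ, as log λ ≥ log 2 > 1/2. -/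
theorem exists_isPaddedBundle_doublingConstant [Nontrivial X] :
    ∃ β : ℤ → PMF (Setoid X),
      IsPaddedBundle (fun _ _ => 1 / (108 * Real.log (doublingConstant X))) β := by
  have h2 : (2 : ℝ) ≤ doublingConstant X := by exact_mod_cast two_le_doublingConstant
  have hlog2 := Real.log_two_gt_d9
  have hlog : Real.log 2 ≤ Real.log (doublingConstant X) := Real.log_le_log (by norm_num) h2
  set l := Real.log (doublingConstant X)
  have hl : 0.69 < l := by linarith
  have : ∀ u : ℤ, ∃ Pr : PMF (Setoid X),
      IsPaddedDecomposition ((2 : ℝ) ^ u) (fun _ => 1 / (108 * l)) Pr := by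
    intro u
    have hΔ : (0 : ℝ) < 2 ^ u := by positivity
    obtain ⟨N, hsep, hcov⟩ := exists_separated_net (X := X) (s := (2 : ℝ) ^ u / 4) (by positivity)
    refine exists_isPaddedDecomposition N hΔ hcov _ (fun _ => by positivity) (fun _ => ?_)
      fun x => ?_
    · exact one_div_le_one_div_of_le (by norm_num) (by linarith)
    · have hg : growth N x ((2 : ℝ) ^ u / 8) (2 ^ u) ≤ 1 + 4 * l := by
        refine (growth_le_one_add_log _ _ _ _).trans ?_
        have hb := ballCount_le_doublingConstant_pow N hΔ hsep x
        rcases Nat.eq_zero_or_pos (ballCount N x (2 ^ u)) with h0 | h0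
        · rw [h0]; simp; linarith
        · have : Real.log (ballCount N x (2 ^ u)) ≤ Real.log ((doublingConstant X : ℝ) ^ 4) :=
            Real.log_le_log (by exact_mod_cast h0) (by exact_mod_cast hb)
          rw [Real.log_pow] at this
          push_cast at this
          linarith
      rw [mul_one_div, div_mul_eq_mul_div, div_le_one (by positivity)]
      linarith
  choose β hβ using this
  exact ⟨β, hβ⟩

end Doubling

/-! ### The modulus and the two bundles -/

section Modulus
variable {X : Type*} [MetricSpace X]

theorem one_le_of_isPaddedBundle [Nonempty X] {α : ℝ} {β : ℤ → PMF (Setoid X)}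
    (h : IsPaddedBundle (fun _ _ => 1 / α) β) : 1 ≤ α := by
  obtain ⟨h0, h1⟩ := (h 0).1 (Classical.arbitrary X)
  rwa [div_le_one (one_div_pos.1 h0)] at h1

theorem one_le_modulus [Nontrivial X] [Fintype X] : 1 ≤ modulus X :=
  le_csInf ⟨_, exists_isPaddedBundle_doublingConstant⟩ fun _ ⟨_, hβ⟩ => one_le_of_isPaddedBundle hβ

theorem modulus_le_log_doublingConstant [Nontrivial X] [Fintype X] :
    modulus X ≤ 108 * Real.log (doublingConstant X) :=
  csInf_le ⟨1, fun _ ⟨_, hβ⟩ => one_le_of_isPaddedBundle hβ⟩ exists_isPaddedBundle_doublingConstant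

/-- Avoids asking whether the infimum is attained; the factor 2 goes into the constant. -/
theorem exists_isPaddedBundle_le_two_mul_modulus [Nontrivial X] [Fintype X] :
    ∃ α : ℝ, α ≤ 2 * modulus X ∧ ∃ β : ℤ → PMF (Setoid X), IsPaddedBundle (fun _ _ => 1 / α) β := by
  have h : modulus X < 2 * modulus X := by linarith [one_le_modulus (X := X)]
  rw [modulus] at h
  obtain ⟨α, hα, hlt⟩ := exists_lt_of_csInf_lt
    (by exact ⟨_, exists_isPaddedBundle_doublingConstant (X := X)⟩) h
  exact ⟨α, hlt.le, hα⟩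

/-- The padded bundle whose padding is governed by the local growth of balls. -/
theorem exists_isPaddedBundle_growth [Fintype X] :
    ∃ β : ℤ → PMF (Setoid X), IsPaddedBundle
      (fun x u => 1 / (18 * (1 + growth univ x ((2 : ℝ) ^ u / 8) (3 * 2 ^ u)))) β := by
  have : ∀ u : ℤ, ∃ Pr : PMF (Setoid X), IsPaddedDecomposition ((2 : ℝ) ^ u)
      (fun x => 1 / (18 * (1 + growth univ x ((2 : ℝ) ^ u / 8) (3 * 2 ^ u)))) Pr := by
    intro u
    have hΔ : (0 : ℝ) < 2 ^ u := by positivity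
    have hg : ∀ x : X, 0 ≤ growth univ x ((2 : ℝ) ^ u / 8) (3 * 2 ^ u) :=
      fun x => growth_nonneg _ _ _ _
    refine exists_isPaddedDecomposition univ hΔ (fun x => ⟨x, mem_univ x, ?_⟩) _ (fun x => ?_)
      (fun x => ?_) fun x => ?_
    · rw [dist_self]; positivity
    · have := hg x
      positivity
    · exact one_div_le_one_div_of_le (by norm_num) (by linarith [hg x])
    · have h1 : growth univ x ((2 : ℝ) ^ u / 8) (2 ^ u) ≤
          growth univ x ((2 : ℝ) ^ u / 8) (3 * 2 ^ u) := growth_mono _ _ _ (by linarith)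
      have h2 := hg x
      rw [mul_one_div, div_mul_eq_mul_div, div_le_one (by positivity)]
      linarith
  choose β hβ using this
  exact ⟨β, hβ⟩

end Modulus

/-! ### Taking p-th roots and assembling the embedding -/

theorem le_of_rpow_bound {p D t d : ℝ} (hp : 1 ≤ p) (hD : 0 ≤ D) (ht : 0 < t) (hd : 0 ≤ d)
    (h : t / 2 * (d / (108 * t)) ^ p ≤ D ^ p) : 1 / 216 * t ^ (1 / p - 1) * d ≤ D := by
  have hp0 : 0 < p := by linarith
  have h1 : (1 / 2 : ℝ) ≤ (1 / 2) ^ (1 / p) := by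
    have := Real.rpow_le_rpow_of_exponent_ge (x := (1 / 2 : ℝ)) (by norm_num) (by norm_num)
      (div_le_one_of_le₀ hp hp0.le : 1 / p ≤ 1)
    rwa [Real.rpow_one] at this
  have h2 := Real.rpow_le_rpow (by positivity) h (by positivity : 0 ≤ 1 / p)
  rw [Real.mul_rpow (by positivity) (by positivity), ← Real.rpow_mul (by positivity),
    ← Real.rpow_mul hD, mul_one_div_cancel hp0.ne', Real.rpow_one, Real.rpow_one,
    div_eq_mul_one_div t 2, Real.mul_rpow ht.le (by norm_num)] at h2
  refine le_trans ?_ h2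
  rw [Real.rpow_sub ht, Real.rpow_one]
  have : 1 / 216 * (t ^ (1 / p) / t) * d = t ^ (1 / p) * (1 / 2) * (d / (108 * t)) := by
    field_simp; ring
  rw [this]
  gcongr

theorem le_of_rpow_le_mul {p D A d : ℝ} (hp : 1 ≤ p) (hD : 0 ≤ D) (hA : 0 ≤ A) (hd : 0 ≤ d)
    (h : D ^ p ≤ 72 * A * d ^ p) : D ≤ 72 * A ^ (1 / p) * d := by
  have hp0 : 0 < p := by linarith
  have h2 := Real.rpow_le_rpow (by positivity) h (by positivity : 0 ≤ 1 / p)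
  rw [Real.mul_rpow (by positivity) (by positivity), Real.mul_rpow (by norm_num) hA,
    ← Real.rpow_mul hD, ← Real.rpow_mul hd, mul_one_div_cancel hp0.ne', Real.rpow_one,
    Real.rpow_one] at h2
  refine h2.trans ?_
  have h1 : (72 : ℝ) ^ (1 / p) ≤ 72 := by
    have := Real.rpow_le_rpow_of_exponent_le (x := (72 : ℝ)) (by norm_num)
      (div_le_one_of_le₀ hp hp0.le : 1 / p ≤ 1)
    rwa [Real.rpow_one] at this
  gcongr

theorem cLp_le_of_ne_top {X : Type*} [MetricSpace X] [Fintype X] [Nontrivial X] (p : ℝ≥0∞)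
    [Fact (1 ≤ p)] (hp : p ≠ ∞) :
    cLp p X ≤ ENNReal.ofReal (31104 * (modulus X ^ (1 - 1 / p.toReal) *
      Real.log (Fintype.card X) ^ (1 / p.toReal))) := by
  classical
  have : Finite (Setoid X) := Finite.of_injective (fun (P : Setoid X) x y => P x y)
    fun P Q h => Setoid.ext fun x y => iff_of_eq (congrFun₂ h x y)
  have : Fintype (Setoid X) := Fintype.ofFinite _
  have hp1 : 1 ≤ p.toReal := by
    have := ENNReal.toReal_mono hp (Fact.out : 1 ≤ p)
    simpa using this
  have hp0 : 0 < p.toReal := by linarith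
  obtain ⟨α, hα, β₀, hβ₀⟩ := exists_isPaddedBundle_le_two_mul_modulus (X := X)
  obtain ⟨β₁, hβ₁⟩ := exists_isPaddedBundle_growth (X := X)
  have hα1 : 1 ≤ α := one_le_of_isPaddedBundle hβ₀
  have hscale : ∀ q : X × X, ∃ j : ℤ, q.1 ≠ q.2 →
      (2 : ℝ) ^ j < dist q.1 q.2 ∧ dist q.1 q.2 ≤ 2 * 2 ^ j := by
    intro q
    by_cases h : q.1 = q.2
    · exact ⟨0, fun h' => absurd h h'⟩
    · obtain ⟨j, h1, h2⟩ := exists_mem_Ioc_zpow (dist_pos.2 h) one_lt_two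
      refine ⟨j, fun _ => ⟨h1, ?_⟩⟩
      rwa [zpow_add_one₀ two_ne_zero, mul_comm] at h2
  choose j hj using hscale
  let J : Finset ℤ := univ.image j
  -- One embedding carries the coordinates of both bundles, so the energies add and either may be
  -- used for a given pair.
  let β : Bool → ℤ → PMF (Setoid X) := fun b => if b then β₁ else β₀
  obtain ⟨f, hf⟩ := exists_toLp_dist_rpow (X := X) p hp ((univ : Finset Bool) ×ˢ coordIndex X J)
    (fun i => 1 / i.2.1 * (β i.1 i.2.2.1 i.2.2.2.1).toReal) (fun i _ => by positivity)
    (fun x i => coord i.2.1 i.2.2.1 i.2.2.2.1 i.2.2.2.2 x)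
  have hfe : ∀ x y, dist (f x) (f y) ^ p.toReal =
      energy β₁ J p.toReal x y + energy β₀ J p.toReal x y := by
    intro x y
    rw [hf, sum_product, Fintype.sum_bool]
    rfl
  have hen : ∀ (β : ℤ → PMF (Setoid X)) x y, 0 ≤ energy β J p.toReal x y :=
    fun β x y => sum_nonneg fun i _ => by positivity
  have hn : (2 : ℝ) ≤ Fintype.card X := by exact_mod_cast Fintype.one_lt_card (α := X)
  have hlog2 := Real.log_two_gt_d9
  have hlog : Real.log 2 ≤ Real.log (Fintype.card X) := Real.log_le_log (by norm_num) hn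
  have hH := sum_Icc_one_div_le (Fintype.card X)
  set H := ∑ k ∈ Icc 1 (Fintype.card X), (1 / k : ℝ)
  set l := Real.log (Fintype.card X)
  have hl : 0 < l := by linarith
  set L := 1 / 216 * α ^ (1 / p.toReal - 1)
  have hL : 0 < L := by positivity
  have key : ∀ x y : X, ∀ i ∈ J, (2 : ℝ) ^ i < dist x y → dist x y ≤ 2 * 2 ^ i →
      ballCount univ x ((2 : ℝ) ^ i / 8) ≤ ballCount univ y ((2 : ℝ) ^ i / 8) →
      L * dist x y ≤ dist (f x) (f y) := by
    intro x y i hi h1 h2 h3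
    have h2i : (0 : ℝ) < 2 ^ i := by positivity
    have hρ := half_le_growth h1 h2 h3
    have e1 := le_energy hp0 hi (hβ₁ i) h1
    have e0 := le_energy hp0 hi (hβ₀ i) h1
    set ρ := growth univ x ((2 : ℝ) ^ i / 8) (3 * 2 ^ i)
    have hρ0 : 0 < ρ := by linarith
    rcases le_total α ρ with hle | hle
    · refine le_of_rpow_bound hp1 dist_nonneg (by linarith) dist_nonneg ?_
      rw [hfe]
      refine le_trans ?_ (e0.trans (le_add_of_nonneg_left (hen _ _ _)))
      have : dist x y / (108 * α) ≤ min (1 / α) (1 / 16) * 2 ^ i := by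
        have hm : 1 / (16 * α) ≤ min (1 / α) (1 / 16) := by
          refine le_min ?_ ?_ <;> exact one_div_le_one_div_of_le (by positivity) (by linarith)
        refine le_trans ?_ (mul_le_mul_of_nonneg_right hm h2i.le)
        rw [div_mul_eq_mul_div, div_le_div_iff₀ (by positivity) (by positivity)]
        nlinarith
      gcongr
    · have hb : L * dist x y ≤ 1 / 216 * ρ ^ (1 / p.toReal - 1) * dist x y := by
        have : α ^ (1 / p.toReal - 1) ≤ ρ ^ (1 / p.toReal - 1) :=
          Real.rpow_le_rpow_of_nonpos hρ0 hle
            (sub_nonpos.2 (div_le_one_of_le₀ hp1 hp0.le))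
        simp only [L]
        gcongr
      refine hb.trans (le_of_rpow_bound hp1 dist_nonneg hρ0 dist_nonneg ?_)
      rw [hfe]
      refine le_trans ?_ (e1.trans (le_add_of_nonneg_right (hen _ _ _)))
      have : dist x y / (108 * ρ) ≤ min (1 / (18 * (1 + ρ))) (1 / 16) * 2 ^ i := by
        -- Here ρ ≥ 1/2 gives 1 + ρ ≤ 3ρ. With d(x,y) ≤ 2·2^i this is the source of 108 = 2·54.
        have hm : 1 / (54 * ρ) ≤ min (1 / (18 * (1 + ρ))) (1 / 16) := by
          refine le_min ?_ ?_ <;> exact one_div_le_one_div_of_le (by positivity) (by linarith)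
        refine le_trans ?_ (mul_le_mul_of_nonneg_right hm h2i.le)
        rw [div_mul_eq_mul_div, div_le_div_iff₀ (by positivity) (by positivity)]
        nlinarith
      gcongr
  have hlow : ∀ x y, L * dist x y ≤ dist (f x) (f y) := by
    intro x y
    by_cases hxy : x = y
    · subst hxy; simp
    · obtain ⟨h1, h2⟩ := hj (x, y) hxy
      have hmem : j (x, y) ∈ J := mem_image_of_mem j (mem_univ _)
      rcases le_total (ballCount univ x ((2 : ℝ) ^ j (x, y) / 8))
        (ballCount univ y ((2 : ℝ) ^ j (x, y) / 8)) with h | h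
      · exact key x y _ hmem h1 h2 h
      · rw [dist_comm x y, dist_comm (f x)]
        dsimp only at h1 h2
        rw [dist_comm x y] at h1 h2
        exact key y x _ hmem h1 h2 h
  -- Two energies give 24(1 + log n) ≤ 72 log n, since log n ≥ log 2 > 1/2.
  have hup : ∀ x y, dist (f x) (f y) ≤ 72 * l ^ (1 / p.toReal) * dist x y := by
    intro x y
    refine le_of_rpow_le_mul hp1 dist_nonneg hl.le dist_nonneg ?_
    have u1 := energy_le β₁ J hp0 x y
    have u0 := energy_le β₀ J hp0 x y
    have hd : 0 ≤ dist x y ^ p.toReal := by positivity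
    rw [hfe]
    nlinarith
  refine (cLp_le_of_bounds p f hL (U := 72 * l ^ (1 / p.toReal)) (by positivity)
    fun x y => ⟨hlow x y, hup x y⟩).trans (ENNReal.ofReal_le_ofReal ?_)
  have hm : 1 ≤ modulus X := one_le_modulus
  have hs0 : 0 ≤ 1 - 1 / p.toReal := sub_nonneg.2 (div_le_one_of_le₀ hp1 hp0.le)
  have hs1 : 1 - 1 / p.toReal ≤ 1 := by
    have : 0 ≤ 1 / p.toReal := by positivity
    linarith
  have hαm : α ^ (1 - 1 / p.toReal) ≤ 2 * modulus X ^ (1 - 1 / p.toReal) := by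
    refine (Real.rpow_le_rpow (by linarith) hα hs0).trans ?_
    rw [Real.mul_rpow (by norm_num) (by linarith)]
    have h1 : (2 : ℝ) ^ (1 - 1 / p.toReal) ≤ 2 := by
      have := Real.rpow_le_rpow_of_exponent_le (x := (2 : ℝ)) (by norm_num) hs1
      rwa [Real.rpow_one] at this
    gcongr
  have hLeq : 72 * l ^ (1 / p.toReal) / L =
      15552 * (l ^ (1 / p.toReal) * α ^ (1 - 1 / p.toReal)) := by
    simp only [L]
    rw [show 1 - 1 / p.toReal = -(1 / p.toReal - 1) by ring, Real.rpow_neg (by linarith)]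
    field_simp
    norm_num
  rw [hLeq]
  have hlp : 0 ≤ l ^ (1 / p.toReal) := by positivity
  nlinarith [mul_le_mul_of_nonneg_left hαm hlp]

theorem cLp_top_le {X : Type*} [MetricSpace X] [Finite X] [Nonempty X] :
    cLp ∞ X ≤ 1 := by
  obtain ⟨f, hf⟩ := exists_isometry_Lp_top X
  have := cLp_le_of_bounds ∞ f one_pos one_pos fun x y => by rw [hf, one_mul]; exact ⟨le_rfl, le_rfl⟩
  simpa using this

theorem cLp_le {X : Type*} [MetricSpace X] [Fintype X] [Nontrivial X] (p : ℝ≥0∞)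
    [Fact (1 ≤ p)] :
    cLp p X ≤ ENNReal.ofReal (31104 * (modulus X ^ (1 - (1 / p).toReal) *
      Real.log (Fintype.card X) ^ (1 / p).toReal)) := by
  by_cases hp : p = ∞
  · subst hp
    refine cLp_top_le.trans ?_
    rw [ENNReal.one_le_ofReal]
    have := one_le_modulus (X := X)
    simp
    linarith
  · have := cLp_le_of_ne_top (X := X) p hp
    rwa [show (1 / p).toReal = 1 / p.toReal by simp]

end PaddedEmbedding

theorem theorem1 :
    ∃ C : ℝ, 0 < C ∧
      ∀ (n : ℕ) (X : Type*) [MetricSpace X] [Fintype X], Fintype.card X = n → 2 ≤ n →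
        (∀ (p : ℝ≥0∞) [Fact (1 ≤ p)],
          PaddedEmbedding.cLp p X ≤ ENNReal.ofReal
            (C * (PaddedEmbedding.modulus X ^ (1 - (1 / p).toReal) *
              Real.log n ^ (1 / p).toReal))) ∧
        PaddedEmbedding.cLp 2 X ≤ ENNReal.ofReal
          (C * √(PaddedEmbedding.modulus X * Real.log n)) ∧
        PaddedEmbedding.modulus X ≤ C * Real.log (PaddedEmbedding.doublingConstant X) ∧
        PaddedEmbedding.cLp 2 X ≤ ENNReal.ofReal
          (C * √(Real.log (PaddedEmbedding.doublingConstant X) * Real.log n)) := by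
  -- The factor 11 ≥ √108 pays for replacing α_X by 108 log λ_X under the square root.
  refine ⟨31104 * 11, by norm_num, fun n X _ _ hn h2 => ?_⟩
  subst hn
  have : Nontrivial X := Fintype.one_lt_card_iff_nontrivial.1 h2
  have hm := PaddedEmbedding.one_le_modulus (X := X)
  have hmd := PaddedEmbedding.modulus_le_log_doublingConstant (X := X)
  have hl : 0 ≤ Real.log (Fintype.card X) := Real.log_natCast_nonneg _
  have hd : 0 ≤ Real.log (PaddedEmbedding.doublingConstant X) := Real.log_natCast_nonneg _
  have h := PaddedEmbedding.cLp_le (X := X) 2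
  have e : ((1 : ℝ≥0∞) / 2).toReal = 1 / 2 := by simp
  rw [e, show (1 - 1 / 2 : ℝ) = 1 / 2 by norm_num, ← Real.mul_rpow (by linarith) hl,
    ← Real.sqrt_eq_rpow] at h
  refine ⟨fun p _ => (PaddedEmbedding.cLp_le p).trans (ENNReal.ofReal_le_ofReal ?_),
    h.trans (ENNReal.ofReal_le_ofReal ?_), by linarith, h.trans (ENNReal.ofReal_le_ofReal ?_)⟩
  · gcongr
    norm_num
  · gcongr
    norm_num
  · rw [mul_assoc]
    gcongr
    rw [show (11 : ℝ) = √(11 ^ 2) by rw [Real.sqrt_sq (by norm_num)],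
      ← Real.sqrt_mul (by norm_num)]
    refine Real.sqrt_le_sqrt ?_
    rw [← mul_assoc]
    gcongr
    linarith
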